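/- Let $F$ be a finite field with $q$ elements, let $K/F$ be an extension of degree $r \geq 1$, and let $\Phi : K \to K$, $x \mapsto x^q$. Let $m \geq 1$ and let $e = (e_1, \ldots, e_m) \in \mathbb{Z}^m$ satisfy $\gcd(e_1, \ldots, e_m, r) = 1$. For $u \in \mathbb{Z}^m$ write $e \cdot u = \sum_i e_i u_i$. Let $K[X^{\pm 1}; \theta]$ be the ring of multivariate Ore Laurent polynomials $\sum_{u \in \mathbb{Z}^m} a_u X^u$ (finite sums, $a_u \in K$), with multiplication given by $X^u X^v = X^{u+v}$ and $X^u a = \Phi^{e \cdot u}(a) X^u$ for $a \in K$. Put $$L = \{u \in \mathbb{Z}^m : e \cdot u \in r\mathbb{Z}\}, \qquad H = \mathrm{Hom}(L, F^\times).$$ For each $\gamma \in H$ let $\tilde\gamma : \mathbb{Z}^m \to K^\times$ be any function that extends $\gamma$ and satisfies $\tilde\gamma(u+v) = \tilde\gamma(u)\, \Phi^{e \cdot u}(\tilde\gamma(v))$ for all $u, v \in \mathbb{Z}^m$ (such extensions exist). Let $$\epsilon : K[X^{\pm 1}; \theta] \to \prod_{\gamma \in H} \mathrm{End}_F(K), \qquad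 \sum_u a_u X^u \mapsto \Big(\sum_u a_u \tilde\gamma(u) \Phi^{e \cdot u}\Big)_{\gamma \in H}.$$ This map is $K$-linear, where $K$ acts on $\mathrm{End}_F(K)$ by $(a\varphi)(x) = a\,\varphi(x)$. For a compact convex set $C \subset \mathbb{R}^m$ let $\mathrm{LRM}(e; C)$ be the image under $\epsilon$ of the space of those $\sum_u a_u X^u$ with $a_u = 0$ whenever $u \notin C$. The sum-rank weight of $(\varphi_\gamma)_{\gamma \in H}$ is $\sum_{\gamma} \dim_F \mathrm{im}(\varphi_\gamma)$, and the minimum distance of a $K$-subspace of $\prod_{\gamma \in H} \mathrm{End}_F(K)$ is the minimum sum-rank weight of its nonzero elements. Let $w = (w_1, \ldots, w_m)$ be a $\mathbb{Z}$-basis of $L$ and, for an integer $\delta \geq 0$, let $$\delta S_w = \Big\{\sum_i \lambda_i w_i : \lambda_i \in \mathbb{R}_{\geq 0},\ \sum_i \lambda_i \leq \delta\Big\} \subset \mathbb{R}^m.$$ Then there is a polynomial $P_w \in \mathbb{Q}[X]$ (the Ehrhart polynomial of $S_w$) such that $\delta S_w \cap \mathbb{Z}^m$ is finite with $P_w(\delta)$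 elements for every integer $\delta \geq 0$, and, for every integer $\delta$ with $0 \leq \delta \leq q-2$, the dimension $k$ over $K$ and the minimum distance $d$ of the code $\mathrm{LRM}(e; \delta S_w)$ satisfy $$k = \mathrm{Card}\big(\delta S_w \cap \mathbb{Z}^m\big) = P_w(\delta) \qquad \text{and} \qquad d \geq r\,(q-1)^{m-1}(q-1-\delta).$$ -/

import Mathlib

noncomputable section

namespace OreLRM

/-- The scalar product `e · u = ∑ e_i u_i`. -/
def dot {m : ℕ} (e u : Fin m → ℤ) : ℤ := ∑ i, e i * u i

lemma dot_zero {m : ℕ} (e : Fin m → ℤ) : dot e 0 = 0 := by simp [dot]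

lemma dot_add {m : ℕ} (e u v : Fin m → ℤ) : dot e (u + v) = dot e u + dot e v := by
  simp [dot, mul_add, Finset.sum_add_distrib]

lemma dot_smul {m : ℕ} (e : Fin m → ℤ) (c : ℤ) (u : Fin m → ℤ) :
    dot e (c • u) = c * dot e u := by
  simp only [dot, Pi.smul_apply, smul_eq_mul, Finset.mul_sum]
  exact Finset.sum_congr rfl fun i _ => by ring

section Lattice

variable {m : ℕ}

/-- The lattice `L = {u ∈ ℤ ^ m : e · u ∈ r ℤ}`. -/
def lattice (e : Fin m → ℤ) (r : ℕ) : Submodule ℤ (Fin m → ℤ) where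
  carrier := {u | (r : ℤ) ∣ dot e u}
  zero_mem' := by simp [dot_zero]
  add_mem' := by
    intro a b ha hb
    simp only [Set.mem_ofPred_eq] at ha hb ⊢
    rw [dot_add]
    exact dvd_add ha hb
  smul_mem' := by
    intro c a ha
    simp only [Set.mem_ofPred_eq] at ha ⊢
    rw [dot_smul]
    exact Dvd.dvd.mul_left ha c

lemma mem_lattice {e : Fin m → ℤ} {r : ℕ} {u : Fin m → ℤ} :
    u ∈ lattice e r ↔ (r : ℤ) ∣ dot e u := Iff.rfl

/-- The dilated simplex `δ S_w = {∑ λ_i w_i : λ_i ≥ 0, ∑ λ_i ≤ δ} ⊆ ℝ ^ m`. -/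
def dilatedSimplex (w : Fin m → Fin m → ℤ) (δ : ℕ) : Set (Fin m → ℝ) :=
  {x | ∃ c : Fin m → ℝ, (∀ i, 0 ≤ c i) ∧ ∑ i, c i ≤ (δ : ℝ) ∧
    x = ∑ i, c i • (fun j => (w i j : ℝ))}

/-- The set `C ∩ ℤ ^ m` of lattice points of a subset `C` of `ℝ ^ m`. -/
def integerPoints (C : Set (Fin m → ℝ)) : Set (Fin m → ℤ) :=
  {u | (fun j => (u j : ℝ)) ∈ C}

end Lattice

section Ore

variable (F K : Type*) [Field F] [Fintype F] [Field K] [Algebra F K] [FiniteDimensional F K]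

/-- The Frobenius automorphism `Φ : x ↦ x ^ q` of `K` over `F`, where `q = |F|`. -/
def frob : K ≃ₐ[F] K := FiniteField.frobeniusAlgEquivOfAlgebraic F K

lemma frob_apply (x : K) : frob F K x = x ^ Fintype.card F := rfl

variable {m : ℕ} (e : Fin m → ℤ)

/-- The group of monomials `X ^ u`, `u ∈ ℤ ^ m`: a multiplicative copy of `ℤ ^ m`. It depends
on `F`, `K` and `e` only because it is given below an action on `K` that does. -/
@[nolint unusedArguments]
def Monomials (_F _K : Type*) {m : ℕ} (_e : Fin m → ℤ) : Type := Multiplicative (Fin m → ℤ)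

instance : CommGroup (Monomials F K e) := inferInstanceAs (CommGroup (Multiplicative (Fin m → ℤ)))

/-- The monomial `X ^ u`. -/
def mon (u : Fin m → ℤ) : Monomials F K e := Multiplicative.ofAdd u

variable {F K e} in
/-- The exponent `u` of the monomial `X ^ u`. -/
def expo (x : Monomials F K e) : Fin m → ℤ := Multiplicative.toAdd x

/-- The group homomorphism `X ^ u ↦ Φ ^ (e · u)`. -/
def twist : Monomials F K e →* (K ≃ₐ[F] K) where
  toFun x := frob F K ^ dot e (expo x)
  map_one' := by
    change frob F K ^ dot e 0 = 1
    rw [dot_zero, zpow_zero]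
  map_mul' x y := by
    change frob F K ^ dot e (expo x + expo y) = _
    rw [dot_add, zpow_add]

/-- The monomial `X ^ u` acts on `K` through `Φ ^ (e · u)`. -/
instance : MulSemiringAction (Monomials F K e) K :=
  MulSemiringAction.compHom K (twist F K e)

/-- The ring `K[X₁^{±1}, …, X_m^{±1}; Φ^{e₁}, …, Φ^{e_m}]` of multivariate Ore Laurent
polynomials, with its `K`-vector space structure given by left multiplication. -/
abbrev OreLaurent : Type _ := SkewMonoidAlgebra K (Monomials F K e)

/-- The commutation relation `X ^ u · a = Φ ^ (e · u) (a) · X ^ u`. -/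
lemma mon_mul_scalar (u : Fin m → ℤ) (a : K) :
    (SkewMonoidAlgebra.single (mon F K e u) 1 * SkewMonoidAlgebra.single 1 a : OreLaurent F K e)
      = SkewMonoidAlgebra.single (mon F K e u) ((frob F K ^ dot e u) a) := by
  rw [SkewMonoidAlgebra.single_mul_single, mul_one, one_mul]
  rfl

/-- `X ^ u · X ^ v = X ^ (u + v)`. -/
lemma mon_mul_mon (u v : Fin m → ℤ) :
    (SkewMonoidAlgebra.single (mon F K e u) 1 * SkewMonoidAlgebra.single (mon F K e v) 1 :
      OreLaurent F K e) = SkewMonoidAlgebra.single (mon F K e (u + v)) 1 := by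
  rw [SkewMonoidAlgebra.single_mul_single, smul_one, one_mul]
  rfl

/-- The subspace of Ore polynomials whose support is contained in `C ⊆ ℝ ^ m`. -/
def supportedIn (C : Set (Fin m → ℝ)) : Submodule K (OreLaurent F K e) where
  carrier := {f | ∀ x ∈ f.support, expo x ∈ integerPoints C}
  zero_mem' := by simp
  add_mem' := by
    classical
    intro f g hf hg x hx
    rcases Finset.mem_union.mp (SkewMonoidAlgebra.support_add hx) with h | h
    · exact hf x h
    · exact hg x h
  smul_mem' := by
    intro a f hf x hx
    refine hf x ?_
    rw [SkewMonoidAlgebra.mem_support_iff] at hx ⊢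
    intro h
    apply hx
    rw [SkewMonoidAlgebra.coeff_smul, Finsupp.smul_apply, h, smul_zero]

/-- The lattice `L` of the pair `(e, r)`, where `r = [K : F]`. -/
abbrev oreLattice : Submodule ℤ (Fin m → ℤ) := lattice e (Module.finrank F K)

/-- The group `H = Hom(L, Fˣ)`. -/
abbrev H : Type _ := Multiplicative (oreLattice F K e) →* Fˣ

instance : Finite (H F K e) := by
  obtain ⟨S, hS⟩ := (inferInstance : Module.Finite ℤ (oreLattice F K e)).fg_top
  refine Finite.of_injective
    (fun (γ : H F K e) (s : S) => γ (Multiplicative.ofAdd (s : oreLattice F K e))) ?_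
  intro γ γ' h
  have key : (MonoidHom.toAdditiveRight γ).toIntLinearMap =
      (MonoidHom.toAdditiveRight γ').toIntLinearMap := by
    refine LinearMap.ext_on hS ?_
    intro s hs
    exact congrArg Additive.ofMul (congrFun h ⟨s, hs⟩)
  ext x
  exact congrArg (fun y : Additive Fˣ => ((Additive.toMul y : Fˣ) : F))
    (LinearMap.congr_fun key (Multiplicative.toAdd x))

instance : Fintype (H F K e) := Fintype.ofFinite _

/-- A prolongation of `γ : L → Fˣ` to a function `ℤ ^ m → Kˣ` that satisfies the cocycle
condition. -/
structure Prolongation (γ : H F K e) where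
  /-- The underlying function. -/
  toFun : (Fin m → ℤ) → Kˣ
  prolongs : ∀ u : oreLattice F K e,
    (toFun u : K) = algebraMap F K (γ (Multiplicative.ofAdd u))
  cocycle : ∀ u v : Fin m → ℤ,
    (toFun (u + v) : K) = toFun u * (frob F K ^ dot e u) (toFun v : K)

variable {F K e}

/-- Every `γ : L → Fˣ` has a prolongation. -/
lemma prolongation_nonempty
    (he : Nat.gcd (Finset.univ.gcd fun i => (e i).natAbs) (Module.finrank F K) = 1)
    (γ : H F K e) : Nonempty (Prolongation F K e γ) := by
  classical
  obtain ⟨c, s, hc⟩ : ∃ (c : Fin m → ℤ) (s : ℤ), dot e c = 1 + s * Module.finrank F K := by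
    let I : Ideal ℤ := Ideal.span (Set.range e) ⊔ Ideal.span {(Module.finrank F K : ℤ)}
    obtain ⟨d, hd⟩ := (inferInstance : I.IsPrincipal).principal
    have hdvd : ∀ x ∈ I, d ∣ x := fun x hx => by
      rw [hd] at hx
      exact Ideal.mem_span_singleton.mp hx
    have h1 : d.natAbs ∣ 1 := by
      rw [← he]
      refine Nat.dvd_gcd (Finset.dvd_gcd fun i _ => Int.natAbs_dvd_natAbs.mpr (hdvd _ ?_)) ?_
      · exact Ideal.mem_sup_left (Ideal.subset_span ⟨i, rfl⟩)
      · have := Int.natAbs_dvd_natAbs.mpr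
          (hdvd _ (Ideal.mem_sup_right (Ideal.subset_span (Set.mem_singleton _))))
        simpa using this
    have h2 : (1 : ℤ) ∈ I := by
      rw [hd]
      refine Ideal.mem_span_singleton.mpr ?_
      exact (Int.natAbs_dvd_natAbs (b := 1)).mp (by simpa using h1)
    obtain ⟨a, ha, b, hb, hab⟩ := Submodule.mem_sup.mp h2
    obtain ⟨c, hc⟩ := (Ideal.mem_span_range_iff_exists_fun).mp ha
    obtain ⟨t, ht⟩ := Ideal.mem_span_singleton'.mp hb
    refine ⟨c, -t, ?_⟩
    have : dot e c = a := by rw [← hc, dot]; exact Finset.sum_congr rfl fun i _ => mul_comm _ _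
    rw [this]
    linarith
  set r := Module.finrank F K with hr
  have hmem : ∀ u : Fin m → ℤ, u + (-dot e u) • c ∈ oreLattice F K e := by
    intro u
    rw [mem_lattice, dot_add, dot_smul, hc]
    exact ⟨-(dot e u * s), by ring⟩
  have hrc : (r : ℤ) • c ∈ oreLattice F K e := by
    rw [mem_lattice, dot_smul]
    exact Dvd.intro _ rfl
  have : Finite K := Module.finite_of_finite F
  obtain ⟨α, hα⟩ := FiniteField.unitsMap_norm_surjective F K
    (γ (Multiplicative.ofAdd ⟨(r : ℤ) • c, hrc⟩))
  -- The powers of `(α, Φ)` in the semidirect product of `Kˣ` by the Galois group.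
  let x : Kˣ ⋊[MulDistribMulAction.toMulAut (K ≃ₐ[F] K) Kˣ] (K ≃ₐ[F] K) := ⟨α, frob F K⟩
  have hxr : ∀ n : ℤ, (x ^ n).right = frob F K ^ n := fun n =>
    map_zpow (SemidirectProduct.rightHom
      (φ := MulDistribMulAction.toMulAut (K ≃ₐ[F] K) Kˣ)) x n
  have hfr : frob F K ^ r = 1 := by
    rw [hr, ← FiniteField.orderOf_frobeniusAlgEquivOfAlgebraic F K]
    exact pow_orderOf_eq_one _
  have hx1 : ∀ n : ℕ, (((x ^ n).left : Kˣ) : K) =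
      ∏ i ∈ Finset.range n, (frob F K ^ i) (α : K) := by
    intro n
    induction n with
    | zero => simp
    | succ n ih =>
      have h := hxr n
      rw [zpow_natCast, zpow_natCast] at h
      rw [pow_succ, SemidirectProduct.mul_left, Units.val_mul, ih, Finset.prod_range_succ, h]
      rfl
  have hxpow : ((x ^ r).left : K) = algebraMap F K (Algebra.norm F (α : K)) := by
    rw [hx1, Algebra.norm_eq_prod_automorphisms,
      ← (FiniteField.bijective_frobeniusAlgEquivOfAlgebraic_pow F K).prod_comp,
      Fin.prod_univ_eq_prod_range
        (fun i => (FiniteField.frobeniusAlgEquivOfAlgebraic F K ^ i) (α : K))]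
    rfl
  let g : Kˣ := Units.map (algebraMap F K : F →* K)
    (γ (Multiplicative.ofAdd ⟨(r : ℤ) • c, hrc⟩))
  have hxrg : x ^ r = SemidirectProduct.inl g := by
    ext
    · rw [hxpow, SemidirectProduct.left_inl]
      exact congrArg (algebraMap F K) (congrArg Units.val hα)
    · have h := hxr r
      rw [zpow_natCast, zpow_natCast, hfr] at h
      rw [h]
      rfl
  let toL : (Fin m → ℤ) → Multiplicative (oreLattice F K e) := fun u =>
    Multiplicative.ofAdd ⟨u + (-dot e u) • c, hmem u⟩
  have toL_add : ∀ u v, toL (u + v) = toL u * toL v := by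
    intro u v
    refine congrArg Multiplicative.ofAdd (Subtype.ext ?_)
    change u + v + (-dot e (u + v)) • c = (u + (-dot e u) • c) + (v + (-dot e v) • c)
    rw [dot_add]
    module
  refine ⟨⟨fun u => Units.map (algebraMap F K : F →* K) (γ (toL u)) * (x ^ dot e u).left,
    ?_, ?_⟩⟩
  · rintro ⟨u, hu⟩
    obtain ⟨k, hk⟩ := mem_lattice.mp hu
    have h1 : (x ^ dot e u).left = g ^ k := by
      rw [hk, zpow_mul, zpow_natCast, hxrg, ← map_zpow, SemidirectProduct.left_inl]
    have h2 : (Multiplicative.ofAdd (⟨u, hu⟩ : oreLattice F K e)) =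
        toL u * (Multiplicative.ofAdd ⟨(r : ℤ) • c, hrc⟩) ^ k := by
      refine congrArg Multiplicative.ofAdd (Subtype.ext ?_)
      change u = u + (-dot e u) • c + k • ((r : ℤ) • c)
      rw [hk]
      module
    rw [h1, h2, map_mul, map_zpow, ← map_zpow, ← Units.val_inj.mpr (map_mul _ _ _)]
    rfl
  · intro u v
    simp only [toL_add, map_mul, dot_add, zpow_add, SemidirectProduct.mul_left, Units.val_mul,
      hxr, Units.coe_map, MonoidHom.coe_coe, AlgEquiv.commutes]
    change _ * _ * (_ * (frob F K ^ dot e u) _) = _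
    ring

/-- The evaluation morphism `∑ a_u X ^ u ↦ ∑ a_u γ̃(u) Φ ^ (e · u) ∈ End_F(K)`, as a `K`-linear
map, where `K` acts on `End_F(K)` by `(a φ)(x) = a · φ(x)`. -/
def eval {γ : H F K e} (γt : Prolongation F K e γ) : OreLaurent F K e →ₗ[K] (K →ₗ[F] K) :=
  Finsupp.linearCombination K (fun x : Monomials F K e =>
      (γt.toFun (expo x) : K) • (frob F K ^ dot e (expo x)).toLinearMap) ∘ₗ
    (SkewMonoidAlgebra.coeffLinearEquiv (S := K)).toLinearMap

lemma eval_single {γ : H F K e} (γt : Prolongation F K e γ) (u : Fin m → ℤ) (a : K) :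
    eval γt (SkewMonoidAlgebra.single (mon F K e u) a) =
      (a * γt.toFun u) • (frob F K ^ dot e u).toLinearMap := by
  rw [mul_smul]
  exact Finsupp.linearCombination_single K a (mon F K e u)

/-- The multievaluation morphism `f ↦ (ε_{γ̃}(f))_{γ ∈ H}`. -/
def multiEval (γt : ∀ γ : H F K e, Prolongation F K e γ) :
    OreLaurent F K e →ₗ[K] (H F K e → K →ₗ[F] K) :=
  LinearMap.pi fun γ => eval (γt γ)

/-- The linearized Reed–Muller code associated to `e` and `C`. -/
def LRM (γt : ∀ γ : H F K e, Prolongation F K e γ) (C : Set (Fin m → ℝ)) :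
    Submodule K (H F K e → K →ₗ[F] K) :=
  (supportedIn F K e C).map (multiEval γt)

/-- The sum-rank weight. -/
def sumRankWeight (φ : H F K e → K →ₗ[F] K) : ℕ :=
  ∑ γ, Module.finrank F (LinearMap.range (φ γ))

/-- The minimum distance of a code: the minimum sum-rank weight of a nonzero codeword. -/
def minDist (C : Submodule K (H F K e → K →ₗ[F] K)) : ℕ :=
  sInf {n | ∃ φ ∈ C, φ ≠ 0 ∧ sumRankWeight φ = n}

end Ore

end OreLRM

end

noncomputable section

namespace OreLRM

/-! Put `N = q - 1`. Since `r ℤ ^ m ⊆ L`, every exponent `u` has an integer vector `scaledCoord w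
u`, which is `r` times its real coordinates in the basis `w`; the simplex becomes the region of
nonnegative vectors with sum at most `r δ`. The value of `ε(X ^ u)` depends only on the class of `u`
modulo `N L`, there are `r N ^ m` classes, and distinct classes have `K`-independent images
(`linearIndependent_torusEval`).

The weight of `φ` is the `K`-dimension of the space of all `ψ ∘ φ`, so any independent family of
left multiples bounds it from below (`card_le_sumRankWeight`). Let `u` be the lexicographically
largest exponent of `f ≠ 0`. Each class `y` whose reduced coordinates dominate those of `u` gives a
monomial multiple of `ε(f)` with leading term `y`: reduction modulo `r N` can only lower the other
terms. Distinct leading terms give independence, so the weight is at least the number of such `y`.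

In `footprint_le_card`, the `i`-th coordinate of a class is below `t_i = scaledCoord w u i` for
exactly a fraction `t_i / (r N)` of the classes. As `∑ t_i ≤ r δ`, a union bound leaves at least `(1
- δ / N) r N ^ m` classes. This is positive for `δ ≤ q - 2`, so `ε` is injective on the polynomials
considered, which gives the dimension. The lattice points are counted by splitting each into a point
of the fundamental box and a nonnegative integral combination of `w`. -/

/-- The number of points of `ℕ ^ m` in the dilated standard simplex. -/
lemma natCard_sum_le (m D : ℕ) :
    Nat.card {n : Fin m → ℕ // ∑ i, n i ≤ D} = (D + m).choose m := by
  -- A slack variable, placed first, turns the inequality into an equality, whose solutions are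
  -- multisets of size `D`.
  let eqv : {P : Fin (m + 1) → ℕ // ∑ i, P i = D} ≃ {n : Fin m → ℕ // ∑ i, n i ≤ D} :=
    { toFun := fun P => ⟨Fin.tail P.1, by
        have h := P.2
        rw [Fin.sum_univ_succ] at h
        exact (Nat.le_add_left _ _).trans h.le⟩
      invFun := fun n => ⟨Fin.cons (D - ∑ i, n.1 i) n.1, by
        rw [Fin.sum_univ_succ]
        simpa using Nat.sub_add_cancel n.2⟩
      left_inv := fun P => by
        have h := P.2
        rw [Fin.sum_univ_succ] at h
        refine Subtype.ext ?_
        have h0 : D - ∑ i, Fin.tail P.1 i = P.1 0 := by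
          simp only [Fin.tail]
          omega
        simp only [h0, Fin.cons_self_tail]
      right_inv := fun n => by simp }
  rw [← Nat.card_congr eqv, ← Nat.card_congr (Sym.equivNatSumOfFintype (Fin (m + 1)) D),
    Nat.card_eq_fintype_card, Sym.card_sym_eq_choose, Fintype.card_fin,
    show m + 1 + D - 1 = D + m by omega]
  rw [← Nat.choose_symm_add]

/-! ### Coordinates in a basis of `L`, and the Ehrhart polynomial of the simplex -/

section Coordinates

variable {m : ℕ} {e : Fin m → ℤ} {r : ℕ}

/-- Multiplication by `r`, which maps `ℤ ^ m` into `L`. -/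
def mulToLattice (e : Fin m → ℤ) (r : ℕ) : (Fin m → ℤ) →ₗ[ℤ] lattice e r :=
  LinearMap.codRestrict (lattice e r) ((r : ℤ) • LinearMap.id) fun u => by
    rw [mem_lattice, LinearMap.smul_apply, LinearMap.id_apply, dot_smul]
    exact Dvd.intro _ rfl

lemma coe_mulToLattice (u : Fin m → ℤ) :
    (mulToLattice e r u : Fin m → ℤ) = (r : ℤ) • u := rfl

/-- The coordinates of `r u` in a basis of `L`. -/
def scaledCoord (w : Module.Basis (Fin m) ℤ (lattice e r)) : (Fin m → ℤ) →ₗ[ℤ] (Fin m → ℤ) :=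
  w.equivFun.toLinearMap ∘ₗ mulToLattice e r

variable (w : Module.Basis (Fin m) ℤ (lattice e r))

lemma sum_scaledCoord (u : Fin m → ℤ) :
    ∑ i, scaledCoord w u i • (w i : Fin m → ℤ) = (r : ℤ) • u := by
  have h := congrArg (Subtype.val) (w.sum_equivFun (mulToLattice e r u))
  rw [coe_mulToLattice] at h
  rw [← h, Submodule.coe_sum]
  rfl

lemma scaledCoord_coe (x : lattice e r) : scaledCoord w x = (r : ℤ) • w.equivFun x := by
  have : mulToLattice e r x = (r : ℤ) • x := rfl
  simp only [scaledCoord, LinearMap.comp_apply, this]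
  exact map_smul w.equivFun (r : ℤ) x

lemma scaledCoord_sum (n : Fin m → ℤ) :
    scaledCoord w (∑ i, n i • (w i : Fin m → ℤ)) = (r : ℤ) • n := by
  have h : ((w.equivFun.symm n : lattice e r) : Fin m → ℤ) = ∑ i, n i • (w i : Fin m → ℤ) := by
    rw [w.equivFun_symm_apply]
    simp
  rw [← h, scaledCoord_coe, LinearEquiv.apply_symm_apply]

lemma scaledCoord_injective (hr : 0 < r) : Function.Injective (scaledCoord w) := by
  intro u v h
  have h2 := (sum_scaledCoord w u).symm.trans ((by rw [h] : _ = _).trans (sum_scaledCoord w v))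
  exact smul_right_injective _ (by exact_mod_cast hr.ne' : (r : ℤ) ≠ 0) h2

/-- The `w i` span `ℝ ^ m`, because the standard basis vectors are integral and so expand in them
with coefficients `scaledCoord / r`. Being `m` in number they are independent over `ℝ`, which forces
`c i = scaledCoord w u i / r`. -/
lemma mem_dilatedSimplex_iff (hr : 0 < r) (δ : ℕ) (u : Fin m → ℤ) :
    u ∈ integerPoints (dilatedSimplex (fun i => (w i : Fin m → ℤ)) δ) ↔
      (∀ i, 0 ≤ scaledCoord w u i) ∧ ∑ i, scaledCoord w u i ≤ r * δ := by
  have hr' : (0 : ℝ) < r := by exact_mod_cast hr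
  let W : Fin m → Fin m → ℝ := fun i j => ((w i : Fin m → ℤ) j : ℝ)
  have hexp : ∀ u : Fin m → ℤ, (fun j => (u j : ℝ)) =
      ∑ i, ((scaledCoord w u i : ℝ) / r) • W i := by
    intro u
    ext j
    have h := congrFun (sum_scaledCoord w u) j
    simp only [Finset.sum_apply, Pi.smul_apply, smul_eq_mul] at h ⊢
    have h' : ∑ i, (scaledCoord w u i : ℝ) * W i j = r * u j := by
      simp only [W]
      exact_mod_cast h
    simp only [div_mul_eq_mul_div]
    rw [← Finset.sum_div, h']
    field_simp
  have hspan : ⊤ ≤ Submodule.span ℝ (Set.range W) := by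
    rw [← (Pi.basisFun ℝ (Fin m)).span_eq, Submodule.span_le]
    rintro _ ⟨j, rfl⟩
    have : Pi.basisFun ℝ (Fin m) j = fun k => ((Pi.single j 1 : Fin m → ℤ) k : ℝ) := by
      ext k
      simp [Pi.single_apply]
    rw [this, hexp]
    exact Submodule.sum_mem _ fun i _ => Submodule.smul_mem _ _ (Submodule.subset_span ⟨i, rfl⟩)
  have hli : LinearIndependent ℝ W :=
    linearIndependent_of_top_le_span_of_card_eq_finrank hspan (by simp)
  constructor
  · rintro ⟨c, hc0, hc1, hc⟩
    have hcl : ∀ i, (scaledCoord w u i : ℝ) = r * c i := by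
      intro i
      have h0 : ∑ i, ((scaledCoord w u i : ℝ) / r - c i) • W i = 0 := by
        simp only [sub_smul, Finset.sum_sub_distrib]
        rw [← hexp u, hc, sub_self]
      have := Fintype.linearIndependent_iff.mp hli _ h0 i
      field_simp at this
      linarith
    refine ⟨fun i => ?_, ?_⟩
    · have : (0 : ℝ) ≤ scaledCoord w u i := by
        rw [hcl]
        exact mul_nonneg hr'.le (hc0 i)
      exact_mod_cast this
    · have : ∑ i, (scaledCoord w u i : ℝ) ≤ r * δ := by
        simp only [hcl]
        rw [← Finset.mul_sum]
        exact mul_le_mul_of_nonneg_left hc1 hr'.le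
      exact_mod_cast this
  · rintro ⟨h0, h1⟩
    refine ⟨fun i => (scaledCoord w u i : ℝ) / r, fun i => ?_, ?_, hexp u⟩
    · exact div_nonneg (by exact_mod_cast h0 i) hr'.le
    · rw [← Finset.sum_div, div_le_iff₀ hr', mul_comm]
      exact_mod_cast h1

/-- The integer points of the half-open fundamental parallelotope of `w`. -/
def fundamentalBox : Set (Fin m → ℤ) :=
  {v | ∀ i, 0 ≤ scaledCoord w v i ∧ scaledCoord w v i < r}

lemma finite_fundamentalBox (hr : 0 < r) : (fundamentalBox w).Finite := by
  refine Set.Finite.of_finite_image (f := scaledCoord w) ?_ (scaledCoord_injective w hr).injOn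
  refine (Set.finite_Icc (0 : Fin m → ℤ) fun _ => (r : ℤ)).subset ?_
  rintro _ ⟨v, hv, rfl⟩
  exact ⟨fun i => (hv i).1, fun i => (hv i).2.le⟩

/-- The least dilation factor for which the dilated simplex contains `v`. -/
def ceilDegree (v : Fin m → ℤ) : ℕ := (⌈((∑ i, scaledCoord w v i : ℤ) : ℚ) / r⌉).toNat

lemma ceilDegree_le {v : Fin m → ℤ} (hv : v ∈ fundamentalBox w) : ceilDegree w v ≤ m := by
  rw [ceilDegree, Int.toNat_le, Int.ceil_le]
  refine div_le_of_le_mul₀ (by positivity) (by positivity) ?_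
  have : ∑ i, scaledCoord w v i ≤ m * (r : ℤ) := by
    refine (Finset.sum_le_sum fun i _ => (hv i).2.le).trans ?_
    simp
  exact_mod_cast this

lemma ceilDegree_le_iff (hr : 0 < r) {v : Fin m → ℤ} (k : ℕ) :
    ceilDegree w v ≤ k ↔ ∑ i, scaledCoord w v i ≤ r * k := by
  have hr' : (0 : ℚ) < r := by exact_mod_cast hr
  rw [ceilDegree, Int.toNat_le, Int.ceil_le, div_le_iff₀ hr', mul_comm]
  norm_cast

lemma scaledCoord_add_sum (v n : Fin m → ℤ) (i : Fin m) :
    scaledCoord w (v + ∑ i, n i • (w i : Fin m → ℤ)) i = scaledCoord w v i + r * n i := by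
  rw [map_add, scaledCoord_sum]
  rfl

/-- Every integer point of a dilated simplex is uniquely a point of the fundamental box plus a
nonnegative integral combination of the `w i`. -/
def simplexPointsEquiv (hr : 0 < r) (δ : ℕ) :
    integerPoints (dilatedSimplex (fun i => (w i : Fin m → ℤ)) δ) ≃
      Σ v : fundamentalBox w, {n : Fin m → ℕ // ceilDegree w v.1 + ∑ i, n i ≤ δ} where
  toFun u := by
    have hr' : (0 : ℤ) < r := by exact_mod_cast hr
    have hu := (mem_dilatedSimplex_iff w hr δ u.1).mp u.2
    -- Division with remainder by `r`: the remainders are the coordinates of the box point, the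
    -- quotients the integral coefficients.
    have hmod : ∀ i, scaledCoord w
        (u.1 + ∑ i, (-(scaledCoord w u.1 i / r)) • (w i : Fin m → ℤ)) i =
          scaledCoord w u.1 i % r := by
      intro i
      rw [scaledCoord_add_sum, mul_neg, ← sub_eq_add_neg, Int.emod_def]
    refine ⟨⟨u.1 + ∑ i, (-(scaledCoord w u.1 i / r)) • (w i : Fin m → ℤ), fun i => ?_⟩,
      fun i => (scaledCoord w u.1 i / r).toNat, ?_⟩
    · rw [hmod]
      exact ⟨Int.emod_nonneg _ hr'.ne', Int.emod_lt_of_pos _ hr'⟩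
    · have hnn : ∀ i, ((scaledCoord w u.1 i / r).toNat : ℤ) = scaledCoord w u.1 i / r :=
        fun i => Int.toNat_of_nonneg (Int.ediv_nonneg (hu.1 i) hr'.le)
      have hle : ∑ i, (scaledCoord w u.1 i / r).toNat ≤ δ := by
        zify
        simp only [hnn]
        refine le_of_mul_le_mul_left (le_trans ?_ hu.2) hr'
        rw [Finset.mul_sum]
        exact Finset.sum_le_sum fun i _ => Int.mul_ediv_self_le hr'.ne'
      rw [← Nat.le_sub_iff_add_le hle, ceilDegree_le_iff w hr]
      simp only [hmod]
      push_cast [hle]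
      simp only [hnn]
      rw [mul_sub, le_sub_iff_add_le, Finset.mul_sum, ← Finset.sum_add_distrib]
      simp only [Int.emod_add_mul_ediv]
      exact hu.2
  invFun p := ⟨p.1.1 + ∑ i, (p.2.1 i : ℤ) • (w i : Fin m → ℤ), by
    have hr' : (0 : ℤ) < r := by exact_mod_cast hr
    rw [mem_dilatedSimplex_iff w hr]
    simp only [scaledCoord_add_sum]
    refine ⟨fun i => add_nonneg (p.1.2 i).1 (by positivity), ?_⟩
    have h := p.2.2
    rw [← Nat.le_sub_iff_add_le ((Nat.le_add_left _ _).trans h), ceilDegree_le_iff w hr] at h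
    push_cast [(Nat.le_add_left _ _).trans p.2.2] at h
    rw [Finset.sum_add_distrib, ← Finset.mul_sum]
    linarith⟩
  left_inv u := by
    have hr' : (0 : ℤ) < r := by exact_mod_cast hr
    have hu := (mem_dilatedSimplex_iff w hr δ u.1).mp u.2
    have hnn : ∀ i, ((scaledCoord w u.1 i / r).toNat : ℤ) = scaledCoord w u.1 i / r :=
      fun i => Int.toNat_of_nonneg (Int.ediv_nonneg (hu.1 i) hr'.le)
    refine Subtype.ext ?_
    simp only [hnn, neg_smul, Finset.sum_neg_distrib, neg_add_cancel_right]
  right_inv p := by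
    have hr' : (0 : ℤ) < r := by exact_mod_cast hr
    have hq : ∀ i, scaledCoord w (p.1.1 + ∑ i, (p.2.1 i : ℤ) • (w i : Fin m → ℤ)) i / r =
        p.2.1 i := by
      intro i
      rw [scaledCoord_add_sum, Int.add_mul_ediv_left _ _ hr'.ne',
        Int.ediv_eq_zero_of_lt (p.1.2 i).1 (p.1.2 i).2, zero_add]
    obtain ⟨⟨v, hv⟩, ⟨n, hn⟩⟩ := p
    have hv' : v + ∑ i, (n i : ℤ) • (w i : Fin m → ℤ) + ∑ i, (-(scaledCoord w
        (v + ∑ i, (n i : ℤ) • (w i : Fin m → ℤ)) i / r)) • (w i : Fin m → ℤ) = v := by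
      simp only [hq, neg_smul, Finset.sum_neg_distrib, add_neg_cancel_right]
    refine Sigma.subtype_ext (Subtype.ext hv') ?_
    ext i
    simp only [hq, Int.toNat_natCast]

lemma finite_simplexPoints (hr : 0 < r) (δ : ℕ) :
    (integerPoints (dilatedSimplex (fun i => (w i : Fin m → ℤ)) δ)).Finite := by
  refine Set.Finite.of_finite_image (f := scaledCoord w) ?_ (scaledCoord_injective w hr).injOn
  refine (Set.finite_Icc (0 : Fin m → ℤ) fun _ => (r * δ : ℤ)).subset ?_
  rintro _ ⟨v, hv, rfl⟩
  obtain ⟨h0, h1⟩ := (mem_dilatedSimplex_iff w hr δ v).mp hv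
  exact ⟨h0, fun i => (Finset.single_le_sum (fun j _ => h0 j) (Finset.mem_univ i)).trans h1⟩

/-- Because `k ≤ m`, the binomial coefficient vanishes when `δ < k`, as does the count. One formula,
polynomial in `δ`, thus holds for every `δ ≥ 0`. -/
lemma natCard_add_sum_le {k : ℕ} (hk : k ≤ m) (δ : ℕ) :
    Nat.card {n : Fin m → ℕ // k + ∑ i, n i ≤ δ} = (δ + (m - k)).choose m := by
  rcases le_or_gt k δ with h | h
  · have : ∀ n : Fin m → ℕ, k + ∑ i, n i ≤ δ ↔ ∑ i, n i ≤ δ - k := fun n => by omega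
    simp only [this]
    rw [natCard_sum_le, show δ - k + m = δ + (m - k) by omega]
  · have : IsEmpty {n : Fin m → ℕ // k + ∑ i, n i ≤ δ} := ⟨fun n => by have := n.2; omega⟩
    rw [Nat.card_of_isEmpty, Nat.choose_eq_zero_of_lt (by omega)]

/-- The Ehrhart polynomial of the simplex `S_w`. -/
lemma exists_ehrhart (hr : 0 < r) :
    ∃ P : Polynomial ℚ, ∀ d : ℕ,
      ((integerPoints (dilatedSimplex (fun i => (w i : Fin m → ℤ)) d)).ncard : ℚ) =
        P.eval (d : ℚ) := by
  have : Fintype (fundamentalBox w) := (finite_fundamentalBox w hr).fintype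
  refine ⟨∑ v : fundamentalBox w, Polynomial.C ((m.factorial : ℚ)⁻¹) *
    (descPochhammer ℚ m).comp (Polynomial.X + Polynomial.C ((m - ceilDegree w v.1 : ℕ) : ℚ)),
    fun d => ?_⟩
  have hfin : ∀ v : fundamentalBox w,
      Finite {n : Fin m → ℕ // ceilDegree w v.1 + ∑ i, n i ≤ d} := fun v =>
    ((Set.finite_Iic fun _ : Fin m => d).subset fun n (hn : _ + _ ≤ d) i =>
      (Finset.single_le_sum (fun j _ => Nat.zero_le (n j)) (Finset.mem_univ i)).trans
        ((Nat.le_add_left _ _).trans hn)).to_subtype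
  rw [← Nat.card_coe_set_eq, Nat.card_congr (simplexPointsEquiv w hr d), Nat.card_sigma,
    Nat.cast_sum, Polynomial.eval_finsetSum]
  refine Finset.sum_congr rfl fun v _ => ?_
  rw [natCard_add_sum_le (ceilDegree_le w v.2), Nat.cast_choose_eq_descPochhammer_div]
  simp only [Polynomial.eval_mul, Polynomial.eval_C, Polynomial.eval_comp, Polynomial.eval_add,
    Polynomial.eval_X]
  push_cast
  rw [div_eq_inv_mul]

end Coordinates

/-! ### The finite group `ℤ ^ m / N L` and the footprint count -/

section Torus

variable {m : ℕ} {e : Fin m → ℤ} {r : ℕ} (w : Module.Basis (Fin m) ℤ (lattice e r)) (N : ℕ)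

/-- The scaled coordinates modulo `r N`; the kernel of this map is `N L`. -/
def residue : (Fin m → ℤ) →+ (Fin m → ZMod (r * N)) where
  toFun u i := (scaledCoord w u i : ZMod (r * N))
  map_zero' := by ext; simp
  map_add' u v := by ext; simp

lemma residue_apply (u : Fin m → ℤ) (i : Fin m) :
    residue w N u i = (scaledCoord w u i : ZMod (r * N)) := rfl

variable {w N}

lemma residue_eq_zero_iff (hr : 0 < r) {u : Fin m → ℤ} :
    residue w N u = 0 ↔ ∃ n : Fin m → ℤ, u = (N : ℤ) • ∑ i, n i • (w i : Fin m → ℤ) := by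
  constructor
  · intro h
    have h' : ∀ i, ∃ n : ℤ, scaledCoord w u i = (r * N : ℕ) * n := fun i =>
      (ZMod.intCast_zmod_eq_zero_iff_dvd _ _).mp (congrFun h i)
    choose n hn using h'
    refine ⟨n, scaledCoord_injective w hr ?_⟩
    rw [map_smul, scaledCoord_sum]
    ext i
    rw [hn]
    simp only [Pi.smul_apply, smul_eq_mul]
    push_cast
    ring
  · rintro ⟨n, rfl⟩
    ext i
    rw [residue_apply, map_smul, scaledCoord_sum]
    refine (ZMod.intCast_zmod_eq_zero_iff_dvd _ _).mpr ⟨n i, ?_⟩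
    simp only [Pi.smul_apply, smul_eq_mul]
    push_cast
    ring

/-- Reduction of `e · u` modulo `r`. -/
def dotMod (e : Fin m → ℤ) (r : ℕ) : (Fin m → ℤ) →+ ZMod r where
  toFun u := (dot e u : ZMod r)
  map_zero' := by rw [dot_zero, Int.cast_zero]
  map_add' u v := by rw [dot_add, Int.cast_add]

lemma ker_dotMod (e : Fin m → ℤ) (r : ℕ) : (dotMod e r).ker = (lattice e r).toAddSubgroup := by
  ext u
  exact ZMod.intCast_zmod_eq_zero_iff_dvd _ _

/-- The integers whose class modulo `r` is attained form a subgroup containing `r` and every `e i`;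
its generator divides all of them, hence is `±1`. -/
lemma dotMod_surjective (he : Nat.gcd (Finset.univ.gcd fun i => (e i).natAbs) r = 1) :
    Function.Surjective (dotMod e r) := by
  have hrange : ∀ i, ((e i : ℤ) : ZMod r) ∈ (dotMod e r).range := fun i =>
    ⟨Pi.single i 1, congrArg (Int.cast) (by simp [dot, Pi.single_apply])⟩
  have hone : (1 : ZMod r) ∈ (dotMod e r).range := by
    let I : AddSubgroup ℤ := (dotMod e r).range.comap (Int.castAddHom (ZMod r))
    obtain ⟨d, hd⟩ := Int.subgroup_cyclic I
    have hdvd : ∀ x ∈ I, d ∣ x := fun x hx => by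
      rw [hd, ← AddSubgroup.zmultiples_eq_closure] at hx
      exact Int.mem_zmultiples_iff.mp hx
    have h1 : d.natAbs ∣ 1 := by
      rw [← he]
      refine Nat.dvd_gcd (Finset.dvd_gcd fun i _ => Int.natAbs_dvd_natAbs.mpr (hdvd _ (hrange i)))
        ?_
      have hrI : (r : ℤ) ∈ I := by
        change ((r : ℤ) : ZMod r) ∈ (dotMod e r).range
        rw [Int.cast_natCast, ZMod.natCast_self]
        exact zero_mem _
      simpa using Int.natAbs_dvd_natAbs.mpr (hdvd _ hrI)
    have h2 : (1 : ℤ) ∈ I := by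
      rw [hd, ← AddSubgroup.zmultiples_eq_closure]
      exact Int.mem_zmultiples_iff.mpr ((Int.natAbs_dvd_natAbs (b := 1)).mp (by simpa using h1))
    simpa using (show ((1 : ℤ) : ZMod r) ∈ (dotMod e r).range from h2)
  intro x
  obtain ⟨u, hu⟩ := hone
  refine ⟨(x.cast : ℤ) • u, ?_⟩
  rw [map_zsmul, hu, zsmul_one]
  exact ZMod.intCast_zmod_cast x

/-- The coordinates of a point of `L`, modulo `N`. -/
def latticeMod (w : Module.Basis (Fin m) ℤ (lattice e r)) (N : ℕ) :
    (lattice e r).toAddSubgroup →+ (Fin m → ZMod N) where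
  toFun x i := (w.equivFun x i : ZMod N)
  map_zero' := by
    ext i
    exact (congrArg (fun y : Fin m → ℤ => (y i : ZMod N)) (map_zero w.equivFun)).trans
      Int.cast_zero
  map_add' x y := by
    ext i
    exact (congrArg (fun y : Fin m → ℤ => (y i : ZMod N)) (map_add w.equivFun x y)).trans
      (Int.cast_add _ _)

/-- The kernel is `N L ⊆ L`, so its index is `[ℤ ^ m : L] [L : N L]`. The gcd condition makes the
first factor exactly `r`. -/
lemma natCard_range_residue (hr : 0 < r) (hN : 0 < N)
    (he : Nat.gcd (Finset.univ.gcd fun i => (e i).natAbs) r = 1) :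
    Nat.card (residue w N).range = r * N ^ m := by
  have : NeZero N := ⟨hN.ne'⟩
  have hle : (residue w N).ker ≤ (lattice e r).toAddSubgroup := by
    intro u hu
    obtain ⟨n, rfl⟩ := (residue_eq_zero_iff hr).mp hu
    exact Submodule.smul_mem _ _ (Submodule.sum_mem _ fun i _ => Submodule.smul_mem _ _ (w i).2)
  have h1 : (lattice e r).toAddSubgroup.index = r := by
    rw [← ker_dotMod, AddSubgroup.index_ker,
      AddMonoidHom.range_eq_top.mpr (dotMod_surjective he)]
    simp
  have h2 : (residue w N).ker.relIndex (lattice e r).toAddSubgroup = N ^ m := by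
    have hker : (residue w N).ker.addSubgroupOf (lattice e r).toAddSubgroup =
        (latticeMod w N).ker := by
      ext x
      rw [AddSubgroup.mem_addSubgroupOf, AddMonoidHom.mem_ker, AddMonoidHom.mem_ker, funext_iff,
        funext_iff]
      refine forall_congr' fun i => ?_
      have hx : scaledCoord w (x : Fin m → ℤ) i = r * w.equivFun x i :=
        congrFun (scaledCoord_coe w x) i
      rw [residue_apply, hx]
      refine (ZMod.intCast_zmod_eq_zero_iff_dvd _ _).trans
        (Iff.trans ?_ (ZMod.intCast_zmod_eq_zero_iff_dvd _ _).symm)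
      push_cast
      exact mul_dvd_mul_iff_left (by exact_mod_cast hr.ne')
    have hsurj : Function.Surjective (latticeMod w N) := by
      intro x
      refine ⟨w.equivFun.symm fun i => (x i).cast, ?_⟩
      ext i
      have := congrFun (LinearEquiv.apply_symm_apply w.equivFun fun i => ((x i).cast : ℤ)) i
      exact (congrArg (fun a : ℤ => (a : ZMod N)) this).trans (ZMod.intCast_zmod_cast (x i))
    rw [AddSubgroup.relIndex, hker, AddSubgroup.index_ker, AddMonoidHom.range_eq_top.mpr hsurj]
    simp
  rw [← AddSubgroup.index_ker, ← AddSubgroup.relIndex_mul_index hle, h1, h2, mul_comm]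

/-- Equidistribution: the coordinates of the torus are uniformly distributed. -/
lemma card_val_lt [NeZero (r * N)] [Fintype (residue w N).range] (u : Fin m → ℤ) (i : Fin m)
    {t : ℕ} (ht : (t : ℤ) = scaledCoord w u i) (htM : t < r * N) :
    (r * N) * (Finset.univ.filter fun y : (residue w N).range => (y.1 i).val < t).card =
      t * Fintype.card (residue w N).range := by
  -- Translation by the class of `u` lowers the representative by `t`, with a wrap-around of `r N`
  -- exactly when it was below `t`. Translation permutes the group, so the sum of representatives is
  -- unchanged and this counts the wrap-arounds.
  have hstep : ∀ y : (residue w N).range,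
      (((y - (residue w N).rangeRestrict u).1 i).val : ℤ) =
        (y.1 i).val - t + (r * N : ℕ) * (if (y.1 i).val < t then 1 else 0) := by
    intro y
    have hlt := ZMod.val_lt (y.1 i)
    have hy : (y - (residue w N).rangeRestrict u).1 i =
        (((y.1 i).val - t : ℤ) : ZMod (r * N)) := by
      have : (y - (residue w N).rangeRestrict u).1 i = y.1 i - residue w N u i := rfl
      rw [this, residue_apply, ← ht]
      simp
    rw [hy, ZMod.val_intCast]
    split_ifs with h
    · rw [← Int.add_emod_right, Int.emod_eq_of_lt (by omega) (by omega)]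
      ring
    · rw [Int.emod_eq_of_lt (by omega) (by omega)]
      ring
  have hsum := (Equiv.subRight ((residue w N).rangeRestrict u)).sum_comp
    fun y : (residue w N).range => (((y.1 i).val : ℕ) : ℤ)
  simp only [Equiv.subRight_apply, hstep] at hsum
  rw [Finset.sum_add_distrib, Finset.sum_sub_distrib, ← Finset.mul_sum, Finset.sum_boole] at hsum
  simp only [Finset.sum_const, Finset.card_univ, nsmul_eq_mul] at hsum
  refine Nat.cast_injective (R := ℤ) ?_
  push_cast at hsum ⊢
  linarith

/-- The footprint bound on the torus. -/
lemma footprint_le_card [Fintype (residue w N).range] (hm : 0 < m) (hr : 0 < r) {δ : ℕ}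
    (hδ : δ < N) (he : Nat.gcd (Finset.univ.gcd fun i => (e i).natAbs) r = 1) {u : Fin m → ℤ}
    (hu : u ∈ integerPoints (dilatedSimplex (fun i => (w i : Fin m → ℤ)) δ)) :
    r * N ^ (m - 1) * (N - δ) ≤ (Finset.univ.filter fun y : (residue w N).range =>
      ∀ i, scaledCoord w u i ≤ (y.1 i).val).card := by
  classical
  have hN : 0 < N := by omega
  have : NeZero (r * N) := ⟨(Nat.mul_pos hr hN).ne'⟩
  obtain ⟨h0, h1⟩ := (mem_dilatedSimplex_iff w hr δ u).mp hu
  have ht : ∀ i, ((scaledCoord w u i).toNat : ℤ) = scaledCoord w u i := fun i =>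
    Int.toNat_of_nonneg (h0 i)
  have hsum : ∑ i, (scaledCoord w u i).toNat ≤ r * δ := by
    zify
    simpa only [ht] using h1
  set Z := Finset.univ.filter fun y : (residue w N).range =>
    ∀ i, scaledCoord w u i ≤ (y.1 i).val with hZ
  let B : Fin m → Finset (residue w N).range := fun i =>
    Finset.univ.filter fun y => (y.1 i).val < (scaledCoord w u i).toNat
  have hcover : Fintype.card (residue w N).range ≤ Z.card + ∑ i, (B i).card := by
    rw [← Finset.card_univ]
    refine (Finset.card_le_card (t := Z ∪ Finset.univ.biUnion B) fun y _ => ?_).trans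
      ((Finset.card_union_le _ _).trans (Nat.add_le_add_left Finset.card_biUnion_le _))
    by_cases hy : ∀ i, scaledCoord w u i ≤ (y.1 i).val
    · exact Finset.mem_union_left _ (Finset.mem_filter.mpr ⟨Finset.mem_univ _, hy⟩)
    · push Not at hy
      obtain ⟨i, hi⟩ := hy
      refine Finset.mem_union_right _ (Finset.mem_biUnion.mpr ⟨i, Finset.mem_univ _, ?_⟩)
      refine Finset.mem_filter.mpr ⟨Finset.mem_univ _, ?_⟩
      zify
      rwa [ht]
  have hB : ∀ i, (r * N) * (B i).card =
      (scaledCoord w u i).toNat * Fintype.card (residue w N).range := fun i =>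
    card_val_lt u i (ht i) <| ((Finset.single_le_sum (fun j _ => Nat.zero_le _)
      (Finset.mem_univ i)).trans hsum).trans_lt (Nat.mul_lt_mul_of_pos_left hδ hr)
  have hcard : Fintype.card (residue w N).range = r * N ^ m := by
    rw [← Nat.card_eq_fintype_card, natCard_range_residue hr hN he]
  have hBsum : (r * N) * ∑ i, (B i).card ≤ (r * δ) * (r * N ^ m) := by
    rw [Finset.mul_sum, ← hcard]
    simp only [hB]
    rw [← Finset.sum_mul]
    exact Nat.mul_le_mul_right _ hsum
  have hmain : (r * N) * (r * N ^ m) ≤ (r * N) * Z.card + (r * δ) * (r * N ^ m) := by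
    rw [← hcard] at hBsum ⊢
    exact (Nat.mul_le_mul_left _ hcover).trans (by rw [mul_add]; omega)
  refine Nat.le_of_mul_le_mul_left ?_ (Nat.mul_pos hr hN)
  obtain ⟨k, rfl⟩ : ∃ k, m = k + 1 := ⟨m - 1, by omega⟩
  rw [Nat.add_sub_cancel]
  zify [hδ.le] at hmain ⊢
  rw [pow_succ] at hmain
  linarith

end Torus

/-! ### Independence from leading terms -/

/-- A family of vectors with pairwise distinct leading terms is linearly independent. -/
lemma linearIndependent_of_leading_term {R V ι κ o : Type*} [Field R] [AddCommGroup V] [Module R V]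
    [LinearOrder o] {b : ι → V} (hb : LinearIndependent R b) {ord : ι → o}
    (hord : Function.Injective ord) (t : κ → ι →₀ R) {p : κ → ι} (hp : Function.Injective p)
    (hlead : ∀ z, t z (p z) ≠ 0) (hle : ∀ z j, t z j ≠ 0 → ord j ≤ ord (p z)) :
    LinearIndependent R fun z => Finsupp.linearCombination R b (t z) := by
  have ht : LinearIndependent R t := by
    classical
    rw [linearIndependent_iff']
    intro s c hc
    by_contra! hne
    obtain ⟨z₁, hz₁, hcz₁⟩ := hne
    -- Among the terms with nonzero coefficient, the one with largest leading position is alone in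
    -- reaching that position.
    obtain ⟨z, hz, hmax⟩ := Finset.exists_max_image (s.filter fun z => c z ≠ 0)
      (fun z => ord (p z)) ⟨z₁, Finset.mem_filter.mpr ⟨hz₁, hcz₁⟩⟩
    obtain ⟨hzs, hcz⟩ := Finset.mem_filter.mp hz
    have h := DFunLike.congr_fun hc (p z)
    rw [Finsupp.finsetSum_apply, Finset.sum_eq_single_of_mem z hzs] at h
    · simp only [Finsupp.smul_apply, smul_eq_mul, Finsupp.zero_apply] at h
      exact (mul_ne_zero hcz (hlead z)) h
    · intro y hy hyz
      simp only [Finsupp.smul_apply, smul_eq_mul]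
      by_contra hne
      obtain ⟨h1, h2⟩ := mul_ne_zero_iff.mp hne
      exact hyz (hp (hord (le_antisymm (hmax y (Finset.mem_filter.mpr ⟨hy, h1⟩)) (hle _ _ h2))))
  exact ht.map' (Finsupp.linearCombination R b) (LinearMap.ker_eq_bot.mpr hb)

lemma units_pow_card_sub_one {F : Type*} [Field F] [Fintype F] (x : Fˣ) :
    x ^ (Fintype.card F - 1) = 1 := by
  classical
  rw [← Fintype.card_units]
  exact pow_card_eq_one

/-! ### Characters of `L` with values in `Fˣ` -/

section Characters

variable {F K : Type*} [Field F] [Fintype F] [Field K] [Algebra F K] {m : ℕ} {e : Fin m → ℤ}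
  (w : Module.Basis (Fin m) ℤ (oreLattice F K e))

/-- Characters separate the points of the lattice modulo `(q - 1) L`. -/
lemma residue_eq_of_forall_hom {l l' : oreLattice F K e}
    (h : ∀ γ : H F K e, γ (Multiplicative.ofAdd l) = γ (Multiplicative.ofAdd l')) :
    residue w (Fintype.card F - 1) l = residue w (Fintype.card F - 1) l' := by
  classical
  obtain ⟨g, hg⟩ := IsCyclic.exists_generator (α := Fˣ)
  have hord : orderOf g = Fintype.card F - 1 := by
    rw [orderOf_eq_card_of_forall_mem_zpowers hg, Nat.card_eq_fintype_card, Fintype.card_units]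
  ext i
  -- The character reading off the `i`-th coordinate as an exponent of a generator of `Fˣ`, which
  -- detects it modulo `q - 1`.
  let γ : H F K e :=
    { toFun := fun x => g ^ (w.equivFun (Multiplicative.toAdd x) i)
      map_one' := by
        rw [toAdd_one, map_zero]
        exact zpow_zero g
      map_mul' := fun x y => by
        rw [toAdd_mul, map_add]
        exact zpow_add g _ _ }
  have hγ : g ^ (w.equivFun l i) = g ^ (w.equivFun l' i) := h γ
  have hdvd : ((Fintype.card F - 1 : ℕ) : ℤ) ∣ w.equivFun l i - w.equivFun l' i := by
    rw [← hord, orderOf_dvd_iff_zpow_eq_one, zpow_sub, hγ, mul_inv_cancel]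
  rw [residue_apply, residue_apply, scaledCoord_coe, scaledCoord_coe, ← sub_eq_zero,
    ← Int.cast_sub]
  refine (ZMod.intCast_zmod_eq_zero_iff_dvd _ _).mpr ?_
  simp only [Pi.smul_apply, smul_eq_mul]
  rw [← mul_sub]
  push_cast
  exact mul_dvd_mul_left _ hdvd

/-- A lift of a residue to `ℤ ^ m`. -/
def residueLift (y : (residue w (Fintype.card F - 1)).range) : Fin m → ℤ := y.2.choose

lemma residue_residueLift (y : (residue w (Fintype.card F - 1)).range) :
    residue w (Fintype.card F - 1) (residueLift w y) = y.1 := y.2.choose_spec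

end Characters

/-! ### Evaluation of monomials and the bound on the sum-rank weight -/

section Evaluation

variable {F K : Type*} [Field F] [Fintype F] [Field K] [Algebra F K] [FiniteDimensional F K]
  {m : ℕ} {e : Fin m → ℤ} (γt : ∀ γ : H F K e, Prolongation F K e γ)

/-- The image of the monomial `X ^ u` under the multievaluation morphism. -/
def monEval (u : Fin m → ℤ) : H F K e → K →ₗ[F] K := fun γ =>
  ((γt γ).toFun u : K) • (frob F K ^ dot e u).toLinearMap

lemma monEval_apply (u : Fin m → ℤ) (γ : H F K e) (x : K) :
    monEval γt u γ x = (γt γ).toFun u * (frob F K ^ dot e u) x := rfl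

lemma multiEval_eq_sum (f : OreLaurent F K e) :
    multiEval γt f = ∑ x ∈ f.support, f.coeff x • monEval γt (expo x) := by
  ext1 γ
  rw [Finset.sum_apply]
  exact Finsupp.linearCombination_apply K f.coeff

/-- Evaluation is multiplicative on `X ^ z · a X ^ u`, by the cocycle condition; left multiples of a
codeword can therefore be computed on exponents. -/
lemma monEval_comp_smul (z u : Fin m → ℤ) (a : K) (γ : H F K e) :
    (monEval γt z γ) ∘ₗ (a • monEval γt u) γ =
      ((frob F K ^ dot e z) a • monEval γt (z + u)) γ := by
  ext x
  simp only [LinearMap.comp_apply, Pi.smul_apply, LinearMap.smul_apply, monEval_apply, smul_eq_mul,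
    (γt γ).cocycle, dot_add, zpow_add, AlgEquiv.mul_apply, map_mul]
  ring

lemma frob_zpow_eq_one_iff (k : ℤ) :
    frob F K ^ k = 1 ↔ (Module.finrank F K : ℤ) ∣ k := by
  have : Finite K := Module.finite_of_finite F
  rw [← FiniteField.orderOf_frobeniusAlgEquivOfAlgebraic F K]
  exact orderOf_dvd_iff_zpow_eq_one.symm

variable (w : Module.Basis (Fin m) ℤ (oreLattice F K e))

/-- The exponents differ by an element of `(q - 1) L`. There `Φ ^ (e · u)` is trivial because `Φ`
has order `r`, and `γ` is trivial because `Fˣ` has exponent dividing `q - 1`. -/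
lemma monEval_congr {u v : Fin m → ℤ}
    (h : residue w (Fintype.card F - 1) u = residue w (Fintype.card F - 1) v) :
    monEval γt u = monEval γt v := by
  have h0 : residue w (Fintype.card F - 1) (u - v) = 0 := by rw [map_sub, h, sub_self]
  obtain ⟨n, hn⟩ := (residue_eq_zero_iff Module.finrank_pos).mp h0
  let l : oreLattice F K e := ∑ i, n i • w i
  have hl : u = v + (((Fintype.card F - 1 : ℕ) : ℤ) • l : oreLattice F K e) := by
    rw [eq_add_of_sub_eq' hn]
    simp [l]
  have hf : frob F K ^ dot e ((((Fintype.card F - 1 : ℕ) : ℤ) • l : oreLattice F K e) :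
      Fin m → ℤ) = 1 := (frob_zpow_eq_one_iff _).mpr (mem_lattice.mp (Subtype.property _))
  ext γ x
  have hγ : γ (Multiplicative.ofAdd (((Fintype.card F - 1 : ℕ) : ℤ) • l)) = 1 := by
    rw [ofAdd_zsmul, map_zpow, zpow_natCast, units_pow_card_sub_one]
  rw [monEval_apply, monEval_apply, hl, (γt γ).cocycle, (γt γ).prolongs, hγ, dot_add, zpow_add, hf]
  simp

/-- The images of the monomials, indexed by the residues. -/
def torusEval (y : (residue w (Fintype.card F - 1)).range) : H F K e → K →ₗ[F] K :=
  monEval γt (residueLift w y)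

lemma torusEval_rangeRestrict (u : Fin m → ℤ) :
    torusEval γt w ((residue w (Fintype.card F - 1)).rangeRestrict u) = monEval γt u :=
  monEval_congr γt w (residue_residueLift w _)

lemma neZero_modulus : NeZero (Module.finrank F K * (Fintype.card F - 1)) :=
  ⟨(Nat.mul_pos Module.finrank_pos (Nat.sub_pos_of_lt Fintype.one_lt_card)).ne'⟩

lemma finite_range_residue : Finite (residue w (Fintype.card F - 1)).range := by
  have := neZero_modulus (F := F) (K := K)
  infer_instance

/-- Dedekind's independence is used twice. For the automorphisms `Φ ^ (e · u)`, it splits a relation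
into fibres of equal automorphism. Within a fibre, exponents differ by elements `l` of `L`;
factoring out the value of `γ̃` at one exponent leaves the characters `γ ↦ γ(l)` of `H`, which are
distinct by `residue_eq_of_forall_hom`. -/
lemma linearIndependent_torusEval : LinearIndependent K (torusEval γt w) := by
  classical
  have := finite_range_residue w
  have : Fintype (residue w (Fintype.card F - 1)).range := Fintype.ofFinite _
  let s : (residue w (Fintype.card F - 1)).range → (K ≃ₐ[F] K) := fun y =>
    frob F K ^ dot e (residueLift w y)
  have hs : LinearIndependent K fun σ : K ≃ₐ[F] K => σ.toLinearMap :=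
    (linearIndependent_algHom_toLinearMap F K K).comp
      (fun σ : K ≃ₐ[F] K => (σ : K →ₐ[F] K)) AlgEquiv.coe_toAlgHom_injective
  rw [Fintype.linearIndependent_iff]
  intro a ha y₀
  have hγ : ∀ γ : H F K e, ∑ y with s y = s y₀, a y * (γt γ).toFun (residueLift w y) = 0 := by
    intro γ
    refine Fintype.linearIndependent_iff.mp hs (fun σ => ∑ y with s y = σ,
      a y * (γt γ).toFun (residueLift w y)) ?_ (s y₀)
    have h := congrFun ha γ
    rw [Finset.sum_apply, ← Finset.sum_fiberwise _ s] at h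
    rw [Pi.zero_apply] at h
    rw [← h]
    refine Finset.sum_congr rfl fun σ _ => ?_
    rw [Finset.sum_smul]
    refine Finset.sum_congr rfl fun y hy => ?_
    rw [← (Finset.mem_filter.mp hy).2, mul_smul]
    rfl
  let Y := {y // s y = s y₀}
  have hmem : ∀ y : Y, residueLift w y.1 - residueLift w y₀ ∈ oreLattice F K e := by
    intro y
    rw [mem_lattice, ← frob_zpow_eq_one_iff, sub_eq_add_neg, dot_add, ← neg_one_smul ℤ, dot_smul,
      neg_one_mul, ← sub_eq_add_neg, zpow_sub, mul_inv_eq_one]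
    exact y.2
  let χ : Y → (H F K e →* K) := fun y =>
    { toFun := fun γ => algebraMap F K (γ (Multiplicative.ofAdd ⟨_, hmem y⟩))
      map_one' := by simp
      map_mul' := by simp }
  have hχ : Function.Injective χ := by
    intro y y' h
    have h' := residue_eq_of_forall_hom w (l := ⟨_, hmem y⟩) (l' := ⟨_, hmem y'⟩) fun γ =>
      Units.ext ((algebraMap F K).injective (DFunLike.congr_fun h γ))
    simp only [map_sub, residue_residueLift] at h'
    exact Subtype.ext (Subtype.ext (sub_left_injective h'))
  have hli := (linearIndependent_monoidHom (H F K e) K).comp χ hχ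
  refine Fintype.linearIndependent_iff.mp hli (fun y : Y => a y.1) ?_ ⟨y₀, rfl⟩
  ext γ
  refine (mul_right_inj' (Units.ne_zero ((γt γ).toFun (residueLift w y₀)))).mp ?_
  rw [Pi.zero_apply, mul_zero, ← hγ γ, Finset.sum_apply, Finset.mul_sum,
    Finset.sum_subtype (p := fun y => s y = s y₀) _ (by simp)]
  refine Finset.sum_congr rfl fun y _ => ?_
  have hc := (γt γ).cocycle (residueLift w y₀) (residueLift w y.1 - residueLift w y₀)
  have hp := (γt γ).prolongs ⟨_, hmem y⟩
  rw [add_sub_cancel] at hc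
  rw [hc]
  simp only at hp
  rw [hp, AlgEquiv.commutes]
  simp only [Pi.smul_apply, Function.comp_apply, smul_eq_mul]
  change _ * (_ * (algebraMap F K _)) = _
  ring

/-- Every residue has a lift with scaled coordinates in `[0, r N)`. -/
lemma exists_reduced_lift (y : (residue w (Fintype.card F - 1)).range) :
    ∃ v : Fin m → ℤ, residue w (Fintype.card F - 1) v = y.1 ∧
      ∀ i, scaledCoord w v i = (y.1 i).val := by
  have := neZero_modulus (F := F) (K := K)
  obtain ⟨u, hu⟩ := y.2
  let n : Fin m → ℤ := fun i => 
    -(scaledCoord w u i / (Module.finrank F K * (Fintype.card F - 1) : ℕ))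
  refine ⟨u + ((Fintype.card F - 1 : ℕ) : ℤ) • ∑ i, n i • (w i : Fin m → ℤ), ?_, fun i => ?_⟩
  · rw [map_add, (residue_eq_zero_iff Module.finrank_pos).mpr ⟨n, rfl⟩, add_zero, hu]
  · rw [map_add, map_smul, scaledCoord_sum, ← hu, residue_apply, ZMod.val_intCast, Int.emod_def]
    simp only [Pi.add_apply, Pi.smul_apply, smul_eq_mul, n]
    push_cast
    ring

/-- The dimension of the left ideal generated by an element of `End_F(K) ^ H`. -/
lemma card_le_sumRankWeight {κ : Type*} [Fintype κ] (φ : H F K e → K →ₗ[F] K)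
    (ψ : κ → H F K e → K →ₗ[F] K) (h : LinearIndependent K fun z γ => ψ z γ ∘ₗ φ γ) :
    Fintype.card κ ≤ sumRankWeight φ := by
  -- Since `ψ ∘ φ` depends only on `ψ` restricted to the image of `φ`, independence can be tested in
  -- the product of the `Hom_F(im φ_γ, K)`.
  let ℓ : (∀ γ, LinearMap.range (φ γ) →ₗ[F] K) →ₗ[K] (H F K e → K →ₗ[F] K) :=
    LinearMap.pi fun γ => LinearMap.lcomp K K (φ γ).rangeRestrict ∘ₗ LinearMap.proj γ
  have h' : LinearIndependent K fun z γ => ψ z γ ∘ₗ (LinearMap.range (φ γ)).subtype :=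
    LinearIndependent.of_comp ℓ h
  refine h'.fintype_card_le_finrank.trans ?_
  rw [Module.finrank_pi_fintype]
  exact Finset.sum_le_sum fun γ _ => (Module.finrank_linearMap_self F K _).le

/-- The footprint bound for the sum-rank weight. -/
lemma le_sumRankWeight (hm : 0 < m)
    (he : Nat.gcd (Finset.univ.gcd fun i => (e i).natAbs) (Module.finrank F K) = 1)
    {δ : ℕ} (hδ : δ + 2 ≤ Fintype.card F) {f : OreLaurent F K e} (hf0 : f ≠ 0)
    (hf : f ∈ supportedIn F K e (dilatedSimplex (fun i => (w i : Fin m → ℤ)) δ)) :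
    Module.finrank F K * (Fintype.card F - 1) ^ (m - 1) * (Fintype.card F - 1 - δ) ≤
      sumRankWeight (multiEval γt f) := by
  classical
  have := neZero_modulus (F := F) (K := K)
  have := finite_range_residue w
  have : Fintype (residue w (Fintype.card F - 1)).range := Fintype.ofFinite _
  have hne : f.support.Nonempty :=
    Finset.nonempty_iff_ne_empty.mpr (mt SkewMonoidAlgebra.support_eq_empty.mp hf0)
  obtain ⟨x₀, hx₀, hmax⟩ := Finset.exists_max_image f.support
    (fun x => toLex (scaledCoord w (expo x))) hne
  refine (footprint_le_card hm Module.finrank_pos (by omega) he (hf x₀ hx₀)).trans ?_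
  rw [← Fintype.card_subtype]
  let R := (residue w (Fintype.card F - 1)).range
  let κ := {y : R // ∀ i, scaledCoord w (expo x₀) i ≤ (y.1 i).val}
  choose v hv hvc using exists_reduced_lift w
  -- Multiplication by `X ^ z` carries the leading exponent of `f` to the reduced lift of `y`;
  -- membership in `κ` makes the scaled coordinates of `z` nonnegative.
  let z : κ → Fin m → ℤ := fun y => v y.1 - expo x₀
  let ord : R → Lex (Fin m → ℤ) := fun y => toLex fun i => ((y.1 i).val : ℤ)
  have hord : Function.Injective ord := by
    intro y y' h
    refine Subtype.ext (funext fun i => ZMod.val_injective _ ?_)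
    exact_mod_cast congrFun (toLex.injective h) i
  let p : κ → Monomials F K e → R := fun y x =>
    (residue w (Fintype.card F - 1)).rangeRestrict (z y + expo x)
  let t : κ → R →₀ K := fun y =>
    ∑ x ∈ f.support, Finsupp.single (p y x) ((frob F K ^ dot e (z y)) (f.coeff x))
  have hp₀ : ∀ y : κ, p y x₀ = y.1 := fun y => Subtype.ext <| by
    change residue w (Fintype.card F - 1) (v y.1 - expo x₀ + expo x₀) = _
    rw [sub_add_cancel, hv]
  have hcoord : ∀ (y : κ) (x : Monomials F K e), scaledCoord w (z y + expo x) =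
      (fun i => ((y.1.1 i).val : ℤ)) - scaledCoord w (expo x₀) + scaledCoord w (expo x) := by
    intro y x
    rw [map_add, map_sub]
    congr 2
    exact funext fun i => hvc y.1 i
  have hlt : ∀ (y : κ), ∀ x ∈ f.support, x ≠ x₀ → ord (p y x) < ord y.1 := by
    intro y x hx hne
    have hpos := ((mem_dilatedSimplex_iff w Module.finrank_pos δ _).mp (hf x hx)).1
    -- Both summands have nonnegative coordinates, so reduction modulo `r N` lowers each coordinate
    -- or keeps it.
    have h1 : ord (p y x) ≤ toLex (scaledCoord w (z y + expo x)) := by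
      refine Pi.toLex_monotone fun i => ?_
      change ((((scaledCoord w (z y + expo x) i : ℤ) : ZMod (_ * _)).val : ℕ) : ℤ) ≤ _
      have hnonneg : 0 ≤ scaledCoord w (z y + expo x) i := by
        rw [hcoord]
        exact add_nonneg (sub_nonneg.mpr (y.2 i)) (hpos i)
      rw [ZMod.val_intCast, Int.emod_def]
      exact sub_le_self _ (mul_nonneg (Int.natCast_nonneg _)
        (Int.ediv_nonneg hnonneg (Int.natCast_nonneg _)))
    have h2 : toLex (scaledCoord w (expo x)) < toLex (scaledCoord w (expo x₀)) :=
      lt_of_le_of_ne (hmax x hx) fun h => hne (scaledCoord_injective w Module.finrank_pos h)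
    refine h1.trans_lt ?_
    rw [hcoord, toLex_add]
    refine (add_lt_add_right h2 _).trans_le (le_of_eq ?_)
    rw [← toLex_add, sub_add_cancel]
  refine card_le_sumRankWeight (κ := κ) _ (fun y => monEval γt (z y)) ?_
  have hT : (fun (y : κ) γ => monEval γt (z y) γ ∘ₗ multiEval γt f γ) =
      fun y => Finsupp.linearCombination K (torusEval γt w) (t y) := by
    funext y γ
    simp only [t, map_sum, Finsupp.linearCombination_single, p, torusEval_rangeRestrict]
    rw [multiEval_eq_sum, Finset.sum_apply, Finset.sum_apply]
    refine (map_sum (LinearMap.compRight F (monEval γt (z y) γ)) _ _).trans ?_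
    exact Finset.sum_congr rfl fun x _ => monEval_comp_smul γt _ _ _ γ
  rw [hT]
  refine linearIndependent_of_leading_term (linearIndependent_torusEval γt w) hord t
    (p := Subtype.val) Subtype.val_injective (fun y => ?_) fun y j hj => ?_
  · rw [Finsupp.finsetSum_apply, Finset.sum_eq_single_of_mem x₀ hx₀, hp₀, Finsupp.single_eq_same]
    · exact (map_ne_zero_iff _ (AlgEquiv.injective _)).mpr
        (SkewMonoidAlgebra.mem_support_iff.mp hx₀)
    · intro x hx hne
      exact Finsupp.single_eq_of_ne fun h => (hlt y x hx hne).ne (congrArg ord h.symm)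
  · rw [Finsupp.finsetSum_apply] at hj
    obtain ⟨x, hx, hxj⟩ := Finset.exists_ne_zero_of_sum_ne_zero hj
    have hjx : j = p y x := by
      by_contra h
      exact hxj (Finsupp.single_eq_of_ne h)
    rw [hjx]
    by_cases h : x = x₀
    · rw [h, hp₀]
    · exact (hlt y x hx h).le

end Evaluation

/-! ### Dimension count and conclusion -/

lemma finrank_supportedIn {F K : Type*} [Field K] {m : ℕ} {e : Fin m → ℤ}
    {C : Set (Fin m → ℝ)} (hC : (integerPoints C).Finite) :
    Module.finrank K (supportedIn F K e C) = (integerPoints C).ncard := by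
  let S : Set (Monomials F K e) := expo ⁻¹' integerPoints C
  have h : (supportedIn F K e C).map (SkewMonoidAlgebra.coeffLinearEquiv (S := K)).toLinearMap =
      Finsupp.supported K K S := by
    ext g
    rw [Submodule.mem_map_equiv]
    rfl
  have : Fintype S := hC.fintype
  rw [← LinearEquiv.finrank_map_eq (SkewMonoidAlgebra.coeffLinearEquiv (S := K)), h,
    (Finsupp.supportedEquivFinsupp S).finrank_eq, Module.finrank_finsupp_self,
    ← Nat.card_eq_fintype_card]
  rfl

lemma sumRankWeight_zero {F K : Type*} [Field F] [Fintype F] [Field K] [Algebra F K] {m : ℕ}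
    {e : Fin m → ℤ} : sumRankWeight (0 : H F K e → K →ₗ[F] K) = 0 := by
  refine Finset.sum_eq_zero fun γ _ => ?_
  rw [Pi.zero_apply, LinearMap.range_zero, finrank_bot]

end OreLRM

end

theorem mainTheorem3 {F K : Type*} [Field F] [Fintype F] [Field K] [Algebra F K]
    [FiniteDimensional F K] {m : ℕ} (hm : 0 < m) (e : Fin m → ℤ)
    (he : Nat.gcd (Finset.univ.gcd fun i => (e i).natAbs) (Module.finrank F K) = 1)
    (γt : ∀ γ : OreLRM.H F K e, OreLRM.Prolongation F K e γ)
    (w : Module.Basis (Fin m) ℤ (OreLRM.oreLattice F K e)) :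
    ∃ P : Polynomial ℚ,
      (∀ d : ℕ, (OreLRM.integerPoints
          (OreLRM.dilatedSimplex (fun i => (w i : Fin m → ℤ)) d)).Finite ∧
        ((OreLRM.integerPoints
          (OreLRM.dilatedSimplex (fun i => (w i : Fin m → ℤ)) d)).ncard : ℚ) = P.eval (d : ℚ)) ∧
      ∀ δ : ℕ, δ + 2 ≤ Fintype.card F →
        Module.finrank K
            (OreLRM.LRM γt (OreLRM.dilatedSimplex (fun i => (w i : Fin m → ℤ)) δ)) =
          (OreLRM.integerPoints
            (OreLRM.dilatedSimplex (fun i => (w i : Fin m → ℤ)) δ)).ncard ∧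
        (Module.finrank K
            (OreLRM.LRM γt (OreLRM.dilatedSimplex (fun i => (w i : Fin m → ℤ)) δ)) : ℚ) =
          P.eval (δ : ℚ) ∧
        Module.finrank F K * (Fintype.card F - 1) ^ (m - 1) * (Fintype.card F - 1 - δ) ≤
          OreLRM.minDist
            (OreLRM.LRM γt (OreLRM.dilatedSimplex (fun i => (w i : Fin m → ℤ)) δ)) := by
  have hr : 0 < Module.finrank F K := Module.finrank_pos
  obtain ⟨P, hP⟩ := OreLRM.exists_ehrhart w hr
  refine ⟨P, fun d => ⟨OreLRM.finite_simplexPoints w hr d, hP d⟩, fun δ hδ => ?_⟩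
  set C := OreLRM.dilatedSimplex (fun i => (w i : Fin m → ℤ)) δ with hC
  have hbound : ∀ f ∈ OreLRM.supportedIn F K e C, f ≠ 0 →
      Module.finrank F K * (Fintype.card F - 1) ^ (m - 1) * (Fintype.card F - 1 - δ) ≤
        OreLRM.sumRankWeight (OreLRM.multiEval γt f) := fun f hf hf0 =>
    OreLRM.le_sumRankWeight γt w hm he hδ hf0 hf
  have hpos : 0 < Module.finrank F K * (Fintype.card F - 1) ^ (m - 1) *
      (Fintype.card F - 1 - δ) :=
    Nat.mul_pos (Nat.mul_pos hr (pow_pos (by omega) _)) (by omega)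
  -- A nonzero polynomial in the kernel would have weight `0`, against the positive bound.
  have hinj : ∀ f ∈ OreLRM.supportedIn F K e C, OreLRM.multiEval γt f = 0 → f = 0 := by
    intro f hf h0
    by_contra hne
    have := hbound f hf hne
    rw [h0, OreLRM.sumRankWeight_zero] at this
    omega
  have hk : Module.finrank K (OreLRM.LRM γt C) = (OreLRM.integerPoints C).ncard := by
    rw [← OreLRM.finrank_supportedIn (F := F) (K := K) (e := e)
      (OreLRM.finite_simplexPoints w hr δ)]
    have hmap : OreLRM.LRM γt C =
        ((OreLRM.multiEval γt).domRestrict (OreLRM.supportedIn F K e C)).range :=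
      (LinearMap.range_domRestrict _ _).symm
    rw [hmap]
    refine LinearMap.finrank_range_of_inj (LinearMap.ker_eq_bot.mp ?_)
    exact LinearMap.ker_eq_bot'.mpr fun f hf => Subtype.ext (hinj f.1 f.2 hf)
  refine ⟨hk, hk ▸ hP δ, ?_⟩
  -- In `ℕ` the infimum of the empty set is `0`, so a nonzero codeword is needed; the image of `X ^
  -- 0` is one.
  have hone : SkewMonoidAlgebra.single (OreLRM.mon F K e 0) 1 ∈ OreLRM.supportedIn F K e C := by
    intro x hx
    have hx0 : x = OreLRM.mon F K e 0 := by
      by_contra hne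
      rw [SkewMonoidAlgebra.mem_support_iff, SkewMonoidAlgebra.coeff_single] at hx
      exact hx (Finsupp.single_eq_of_ne hne)
    rw [hx0, hC, OreLRM.mem_dilatedSimplex_iff w hr]
    change (∀ i, 0 ≤ OreLRM.scaledCoord w 0 i) ∧ ∑ i, OreLRM.scaledCoord w 0 i ≤ _
    simp only [map_zero, Pi.zero_apply, le_refl, implies_true, Finset.sum_const_zero, true_and]
    positivity
  have hone0 : (SkewMonoidAlgebra.single (OreLRM.mon F K e 0) 1 : OreLRM.OreLaurent F K e) ≠ 0 :=
    fun h => one_ne_zero (SkewMonoidAlgebra.single_eq_zero.mp h)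
  refine le_csInf ⟨_, _, Submodule.mem_map_of_mem hone, fun h => hone0 (hinj _ hone h), rfl⟩ ?_
  rintro _ ⟨_, ⟨f, hf, rfl⟩, hne, rfl⟩
  exact hbound f hf fun h => hne (by rw [h, map_zero])
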